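/- Let $m>1$ be real, put $k=1-m<0$, and let $j,l$ be integers of the same parity. Write $\operatorname{sn}(x|m),\operatorname{cn}(x|m),\operatorname{dn}(x|m)$ for the Jacobi elliptic functions with parameter $m$ (for every real $m$: the solution of $\operatorname{sn}'=\operatorname{cn}\operatorname{dn}$, $\operatorname{cn}'=-\operatorname{sn}\operatorname{dn}$, $\operatorname{dn}'=-m\operatorname{sn}\operatorname{cn}$ with values $0,1,1$ at $x=0$). Consider the Schrödinger operator $H=-\frac{d^2}{dx^2}+V$ on the real line with the generalized Lamé potential $$V(x)=m\,l(l+1)\operatorname{sn}^2(x|m)-j(j+1)\operatorname{sn}^2\!\left(\sqrt{m-1}\,x\,\middle|\,\tfrac1{1-m}\right).$$ Let $$z=-k^{-1}\operatorname{sn}^2(\sqrt{-k}\,x\,|\,k^{-1})\in[0,-1/k],\qquad z^{1/2}:=(-k)^{-1/2}\operatorname{sn}(\sqrt{-k}\,x\,|\,k^{-1}),$$ $$\mu_1=\operatorname{cn}^l(x|m),\qquad \mu_2=\operatorname{cn}^l(x|m)\,\operatorname{cn}\!\left(\sqrt{m-1}\,x\,\middle|\,\tfrac1{1-m}\right),$$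 so that $\mu_1=(1+z)^{-l/2}$ and $|\mu_2|=(1+z)^{-l/2}(1+kz)^{1/2}$. Let $\mathcal P_n(z)$ be the real span of $1,z,\dots,z^n$ (as functions of $x$), with $\mathcal P_n=0$ for $n<0$. Put $$n_1=\tfrac{l+j}2,\quad n_2=\tfrac{l-j}2-1,\quad \tilde n_1=\tfrac{l-j}2-1,\quad \tilde n_2=\tfrac{l+j}2-1 .$$ Then each of the four spaces $$\mu_1\mathcal P_{n_1}(z),\qquad \mu_1z^{1/2}\mathcal P_{n_2}(z),\qquad \mu_2\mathcal P_{\tilde n_1}(z),\qquad \mu_2z^{1/2}\mathcal P_{\tilde n_2}(z)$$ consists of smooth functions and is mapped into itself by $H$; their dimensions are $\max(n+1,0)$ with $n=n_1,n_2,\tilde n_1,\tilde n_2$ respectively, and their sum is direct. If moreover $|j|\le l$, the four dimensions add up to $2l+1$, and there are exactly $2l+1$ algebraic eigenfunctions: there are $2l+1$ linearly independent real functions, each of them an eigenfunction of $H$ with a real eigenvalue that lies in one of the four spaces, such that every nonzero real function in one of the four spaces that is an eigenfunction of $H$ with a real eigenvalue is a nonzero constant multiple of exactly one of them. -/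

import Mathlib

open Set Filter Topology
open scoped ContDiff

noncomputable section

/-- The incomplete elliptic integral of the first kind
`F(φ|m) = ∫₀^φ dθ / √(1 - m sin² θ)` (`m` is the parameter, the square of the modulus). -/
def ellipticF (m φ : ℝ) : ℝ := ∫ θ in (0 : ℝ)..φ, 1 / √(1 - m * Real.sin θ ^ 2)

/-- The Jacobi amplitude `am(x|m)`, the inverse of `φ ↦ F(φ|m)`, for a parameter `m < 1`
(`F(·|m)` is then a bijection of the real line, see `ellipticF_bijective`). -/
def jacobiAm (m x : ℝ) : ℝ := Function.invFun (ellipticF m) x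

/-- The Jacobi function `sn(x|m)` for real argument and real parameter. For `m > 1` it is given by
the reciprocal-parameter transformation. For every `m`, the functions `sn, cn, dn` are the
solution of the usual initial value problem, see `jacobi_ivp`. -/
def jacobiSn (m x : ℝ) : ℝ :=
  if m < 1 then Real.sin (jacobiAm m x)
  else if m = 1 then Real.tanh x
  else Real.sin (jacobiAm m⁻¹ (√m * x)) / √m

/-- The Jacobi function `cn(x|m)` for real argument and real parameter. -/
def jacobiCn (m x : ℝ) : ℝ :=
  if m < 1 then Real.cos (jacobiAm m x)
  else if m = 1 then 1 / Real.cosh x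
  else √(1 - m⁻¹ * Real.sin (jacobiAm m⁻¹ (√m * x)) ^ 2)

/-- The Jacobi function `dn(x|m)` for real argument and real parameter. -/
def jacobiDn (m x : ℝ) : ℝ :=
  if m < 1 then √(1 - m * Real.sin (jacobiAm m x) ^ 2)
  else if m = 1 then 1 / Real.cosh x
  else Real.cos (jacobiAm m⁻¹ (√m * x))

lemma ellipticF_radicand_pos {m : ℝ} (hm : m < 1) (θ : ℝ) : 0 < 1 - m * Real.sin θ ^ 2 := by
  have h1 := Real.sin_sq_le_one θ
  have h2 := sq_nonneg (Real.sin θ)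
  rcases le_or_gt m 0 with h | h <;> nlinarith

lemma ellipticF_hasDerivAt {m : ℝ} (hm : m < 1) (φ : ℝ) :
    HasDerivAt (ellipticF m) (1 / √(1 - m * Real.sin φ ^ 2)) φ := by
  have hc : Continuous fun θ : ℝ => 1 / √(1 - m * Real.sin θ ^ 2) := by
    refine continuous_const.div (by fun_prop) fun θ => ?_
    exact (Real.sqrt_pos.2 (ellipticF_radicand_pos hm θ)).ne'
  exact intervalIntegral.integral_hasDerivAt_right (hc.intervalIntegrable _ _)
    hc.stronglyMeasurable.stronglyMeasurableAtFilter hc.continuousAt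

lemma ellipticF_strictMono {m : ℝ} (hm : m < 1) : StrictMono (ellipticF m) := by
  refine strictMono_of_deriv_pos fun φ => ?_
  rw [(ellipticF_hasDerivAt hm φ).deriv]
  exact one_div_pos.2 (Real.sqrt_pos.2 (ellipticF_radicand_pos hm φ))

lemma ellipticF_bijective {m : ℝ} (hm : m < 1) : Function.Bijective (ellipticF m) := by
  refine ⟨(ellipticF_strictMono hm).injective, ?_⟩
  have hcont : Continuous (ellipticF m) :=
    continuous_iff_continuousAt.2 fun φ => (ellipticF_hasDerivAt hm φ).continuousAt
  set c : ℝ := 1 / √(1 + |m|) with hc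
  have hc0 : 0 < c := one_div_pos.2 (Real.sqrt_pos.2 (by positivity))
  have hle : ∀ φ : ℝ, c ≤ 1 / √(1 - m * Real.sin φ ^ 2) := fun φ => by
    refine one_div_le_one_div_of_le (Real.sqrt_pos.2 (ellipticF_radicand_pos hm φ))
      (Real.sqrt_le_sqrt ?_)
    have h1 := Real.sin_sq_le_one φ
    have h2 := sq_nonneg (Real.sin φ)
    have h3 := neg_abs_le m
    nlinarith [abs_nonneg m]
  have hmono : Monotone fun φ => ellipticF m φ - c * φ := by
    have hd : ∀ φ, HasDerivAt (fun φ => ellipticF m φ - c * φ)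
        (1 / √(1 - m * Real.sin φ ^ 2) - c * 1) φ := fun φ =>
      (ellipticF_hasDerivAt hm φ).sub ((hasDerivAt_id φ).const_mul c)
    refine monotone_of_deriv_nonneg (fun φ => (hd φ).differentiableAt) fun φ => ?_
    rw [(hd φ).deriv]
    linarith [hle φ]
  have h0 : ellipticF m 0 = 0 := by simp [ellipticF]
  refine hcont.surjective ?_ ?_
  · refine tendsto_atTop_mono' _ ?_ (tendsto_id.const_mul_atTop hc0)
    filter_upwards [eventually_ge_atTop 0] with φ hφ
    have := hmono hφ
    simp only [h0, mul_zero, sub_zero, id] at this ⊢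
    linarith
  · refine tendsto_atBot_mono' _ ?_ (tendsto_id.const_mul_atBot hc0)
    filter_upwards [eventually_le_atBot 0] with φ hφ
    have := hmono hφ
    simp only [h0, mul_zero, sub_zero, id] at this ⊢
    linarith

lemma jacobiAm_hasDerivAt {m : ℝ} (hm : m < 1) (x : ℝ) :
    HasDerivAt (jacobiAm m) √(1 - m * Real.sin (jacobiAm m x) ^ 2) x := by
  have hr : Function.RightInverse (jacobiAm m) (ellipticF m) :=
    Function.rightInverse_invFun (ellipticF_bijective hm).2
  have hcont : Continuous (jacobiAm m) := by
    refine Monotone.continuous_of_surjective ?_ ?_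
    · intro a b hab
      rw [← (ellipticF_strictMono hm).le_iff_le, hr a, hr b]
      exact hab
    · exact (Function.leftInverse_invFun (ellipticF_bijective hm).1).surjective
  have hp := Real.sqrt_pos.2 (ellipticF_radicand_pos hm (jacobiAm m x))
  have h := HasDerivAt.of_local_left_inverse hcont.continuousAt
    (ellipticF_hasDerivAt hm (jacobiAm m x)) (one_div_pos.2 hp).ne'
    (Eventually.of_forall hr)
  simpa using h

lemma jacobiAm_zero {m : ℝ} (hm : m < 1) : jacobiAm m 0 = 0 := by
  have h0 : ellipticF m 0 = 0 := by simp [ellipticF]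
  have := Function.leftInverse_invFun (ellipticF_bijective hm).1 0
  rwa [h0] at this

lemma jacobi_ivp_aux {m : ℝ} (hm : m < 1) (x : ℝ) :
    HasDerivAt (fun x => Real.sin (jacobiAm m x))
        (Real.cos (jacobiAm m x) * √(1 - m * Real.sin (jacobiAm m x) ^ 2)) x ∧
      HasDerivAt (fun x => Real.cos (jacobiAm m x))
        (-(Real.sin (jacobiAm m x) * √(1 - m * Real.sin (jacobiAm m x) ^ 2))) x ∧
      HasDerivAt (fun x => √(1 - m * Real.sin (jacobiAm m x) ^ 2))
        (-(m * Real.sin (jacobiAm m x) * Real.cos (jacobiAm m x))) x := by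
  have ha := jacobiAm_hasDerivAt hm x
  have hr := ellipticF_radicand_pos hm (jacobiAm m x)
  have hs := (Real.sqrt_pos.2 hr).ne'
  refine ⟨ha.sin, by simpa using ha.cos, ?_⟩
  have h := ((((ha.sin).pow 2).const_mul m).const_sub 1).sqrt hr.ne'
  refine HasDerivAt.congr_deriv h ?_
  simp only [Pi.pow_apply]
  field_simp
  norm_num
  ring

/-- The functions `sn, cn, dn` solve the initial value problem `sn' = cn dn`, `cn' = -sn dn`,
`dn' = -m sn cn`, `sn 0 = 0`, `cn 0 = dn 0 = 1`, which characterises them. -/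
theorem jacobi_ivp (m : ℝ) :
    (jacobiSn m 0 = 0 ∧ jacobiCn m 0 = 1 ∧ jacobiDn m 0 = 1) ∧
      ∀ x, HasDerivAt (jacobiSn m) (jacobiCn m x * jacobiDn m x) x ∧
        HasDerivAt (jacobiCn m) (-(jacobiSn m x * jacobiDn m x)) x ∧
        HasDerivAt (jacobiDn m) (-(m * jacobiSn m x * jacobiCn m x)) x := by
  rcases lt_trichotomy m 1 with h | h | h
  · have e1 : jacobiSn m = fun x => Real.sin (jacobiAm m x) := by ext; simp [jacobiSn, h]
    have e2 : jacobiCn m = fun x => Real.cos (jacobiAm m x) := by ext; simp [jacobiCn, h]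
    have e3 : jacobiDn m = fun x => √(1 - m * Real.sin (jacobiAm m x) ^ 2) := by
      ext; simp [jacobiDn, h]
    simp only [e1, e2, e3]
    exact ⟨by simp [jacobiAm_zero h], jacobi_ivp_aux h⟩
  · subst h
    have e1 : jacobiSn 1 = fun x => Real.sinh x / Real.cosh x := by
      ext x; simp [jacobiSn, Real.tanh_eq_sinh_div_cosh]
    have e2 : jacobiCn 1 = fun x => 1 / Real.cosh x := by ext; simp [jacobiCn]
    have e3 : jacobiDn 1 = fun x => 1 / Real.cosh x := by ext; simp [jacobiDn]
    simp only [e1, e2, e3]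
    refine ⟨by simp, fun x => ?_⟩
    have hc := (Real.cosh_pos x).ne'
    have hq := Real.cosh_sq x
    have hcd : HasDerivAt (fun x => 1 / Real.cosh x)
        (-(Real.sinh x / Real.cosh x * (1 / Real.cosh x))) x := by
      refine HasDerivAt.congr_deriv
        ((hasDerivAt_const x (1 : ℝ)).div (Real.hasDerivAt_cosh x) hc) ?_
      field_simp
      ring
    refine ⟨?_, hcd, by simpa using hcd⟩
    refine HasDerivAt.congr_deriv
      ((Real.hasDerivAt_sinh x).div (Real.hasDerivAt_cosh x) hc) ?_
    field_simp
    linarith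
  · have h1 : m⁻¹ < 1 := inv_lt_one_of_one_lt₀ h
    have h2 : ¬ m < 1 := not_lt.2 h.le
    have h3 : m ≠ 1 := h.ne'
    have hm0 : 0 < m := by linarith
    have hs := (Real.sqrt_pos.2 hm0).ne'
    have hss := Real.mul_self_sqrt hm0.le
    have e1 : jacobiSn m = fun x => Real.sin (jacobiAm m⁻¹ (√m * x)) / √m := by
      ext; simp [jacobiSn, h2, h3]
    have e2 : jacobiCn m = fun x => √(1 - m⁻¹ * Real.sin (jacobiAm m⁻¹ (√m * x)) ^ 2) := by
      ext; simp [jacobiCn, h2, h3]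
    have e3 : jacobiDn m = fun x => Real.cos (jacobiAm m⁻¹ (√m * x)) := by
      ext; simp [jacobiDn, h2, h3]
    simp only [e1, e2, e3]
    refine ⟨by simp [jacobiAm_zero h1], fun x => ?_⟩
    obtain ⟨d1, d2, d3⟩ := jacobi_ivp_aux h1 (√m * x)
    have hl : HasDerivAt (fun x => √m * x) √m x := by
      simpa using (hasDerivAt_id x).const_mul √m
    have d1' := (HasDerivAt.comp x d1 hl).div_const √m
    have d2' := HasDerivAt.comp x d2 hl
    have d3' := HasDerivAt.comp x d3 hl
    refine ⟨?_, ?_, ?_⟩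
    · refine HasDerivAt.congr_deriv d1' ?_
      field_simp
    · refine HasDerivAt.congr_deriv d3' ?_
      field_simp
      try rw [Real.sq_sqrt hm0.le]
    · refine HasDerivAt.congr_deriv d2' ?_
      field_simp
      try rw [Real.sq_sqrt hm0.le]

/-- The Schrödinger operator `H = -d²/dx² + V` acting on real functions of a real variable. -/
def schrodingerOp (V ψ : ℝ → ℝ) : ℝ → ℝ := fun x => -iteratedDeriv 2 ψ x + V x * ψ x

/-- The generalized Lamé potential
`V(x) = m l (l+1) sn²(x|m) - j (j+1) sn²(√(m-1) x | 1/(1-m))`. -/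
def genLamePotential (m : ℝ) (l j : ℤ) (x : ℝ) : ℝ :=
  m * l * (l + 1) * jacobiSn m x ^ 2
    - j * (j + 1) * jacobiSn (1 / (1 - m)) (√(m - 1) * x) ^ 2

/-- The algebraic variable `z = -k⁻¹ sn²(√(-k) x | k⁻¹)` with `k = 1 - m < 0`. -/
def lameZ (m x : ℝ) : ℝ :=
  -(1 - m)⁻¹ * jacobiSn (1 / (1 - m)) (√(m - 1) * x) ^ 2

/-- The smooth branch `(-k)^{-1/2} sn(√(-k) x | k⁻¹)`, `k = 1 - m < 0`, of `z^{1/2}`. -/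
def lameSqrtZ (m x : ℝ) : ℝ :=
  jacobiSn (1 / (1 - m)) (√(m - 1) * x) / √(m - 1)

/-- The first gauge factor `μ₁ = cn^l(x|m)`. -/
def lameMu1 (m : ℝ) (l : ℤ) (x : ℝ) : ℝ := jacobiCn m x ^ l

/-- The second gauge factor `μ₂ = cn^l(x|m) cn(√(m-1) x | 1/(1-m))`. -/
def lameMu2 (m : ℝ) (l : ℤ) (x : ℝ) : ℝ :=
  jacobiCn m x ^ l * jacobiCn (1 / (1 - m)) (√(m - 1) * x)

/-- The module `μ · 𝒫ₙ(z) = span {μ, μ z, …, μ zⁿ}` of real functions; it is zero for `n < 0`. -/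
def polyModule (μ z : ℝ → ℝ) (n : ℤ) : Submodule ℝ (ℝ → ℝ) :=
  Submodule.span ℝ {f | ∃ i : ℕ, (i : ℤ) ≤ n ∧ f = fun x => μ x * z x ^ i}

/-- The prefactors `μ₁, μ₁ z^{1/2}, μ₂, μ₂ z^{1/2}` of the four sectors. -/
def sectorGauge (m : ℝ) (l : ℤ) : Fin 4 → ℝ → ℝ :=
  ![lameMu1 m l, fun x => lameMu1 m l x * lameSqrtZ m x,
    lameMu2 m l, fun x => lameMu2 m l x * lameSqrtZ m x]

/-- The degrees `(l+j)/2, (l-j)/2 - 1, (l-j)/2 - 1, (l+j)/2 - 1` of the four sectors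
(the divisions are exact when `l` and `j` have the same parity). -/
def sectorDegree (l j : ℤ) : Fin 4 → ℤ :=
  ![(l + j) / 2, (l - j) / 2 - 1, (l - j) / 2 - 1, (l + j) / 2 - 1]

/-- The four algebraic sectors of the generalized Lamé potential. -/
def algSector (m : ℝ) (l j : ℤ) (i : Fin 4) : Submodule ℝ (ℝ → ℝ) :=
  polyModule (sectorGauge m l i) (lameZ m) (sectorDegree l j i)

/-- An algebraic eigenfunction: a nonzero eigenfunction of `H = -d²/dx² + V` that lies in one of
the four algebraic sectors. -/
def IsAlgEigenfunction (m : ℝ) (l j : ℤ) (ψ : ℝ → ℝ) : Prop :=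
  ψ ≠ 0 ∧ (∃ i, ψ ∈ algSector m l j i) ∧
    ∃ E : ℝ, schrodingerOp (genLamePotential m l j) ψ = E • ψ

end

/-! Put `k = 1 - m` and write `w`, `c`, `d` for `lameSqrtZ`, `lameC`, `lameD`. Then `w' = c d`, `c'
= k w d`, `d' = w c`, with `w² = z`, `c² = 1 + k z`, `d² = 1 + z`. Uniqueness for the Jacobi system
gives `sn(x|m) = w / d` and `cn(x|m) = 1 / d`, so everything is expressed through these three
functions.

Each sector has a gauge factor `g = d^(-l) w^ε c^δ` with `ε, δ ∈ {0, 1}`. In `V - g'' / g` the pole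
at `z = -1` cancels and `α + β z` remains, while `z'²`, `z''` and `g' z' / g` are polynomials in
`z`. Hence `g⁻¹ H g` acts on polynomials in `z` (`schrodingerOp_sectorMap`), by a tridiagonal matrix
in the monomials (`sectorOp_coeff_succ`). Its degree-raising entry vanishes at the degree of the
sector (`sectorUpper_eq_zero`), which gives invariance.

The degree-lowering entries never vanish, so an eigenvector is fixed by its constant coefficient and
eigenvalues within a sector are simple. The operator is also symmetric in `L²` of a quarter period
(`integral_sectorOp_symm`), hence diagonalizable over the reals. So a sector has, up to scaling,
exactly as many eigenfunctions as its dimension. The sectors are independent by parity in `x` and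
the irrationality of `√(1 + k z)`; coinciding eigenvalues in different sectors therefore do no harm,
and the count is the sum of the dimensions. -/

/-! ### The Jacobi system: first integrals, uniqueness, parity. -/

/-- `(s, c, d)` solves the system `s' = c d`, `c' = -s d`, `d' = -m s c` with `s 0 = 0` and
`c 0 = d 0 = 1`. -/
structure IsJacobiTriple (m : ℝ) (s c d : ℝ → ℝ) : Prop where
  s_zero : s 0 = 0
  c_zero : c 0 = 1
  d_zero : d 0 = 1
  s_deriv : ∀ x, HasDerivAt s (c x * d x) x
  c_deriv : ∀ x, HasDerivAt c (-(s x * d x)) x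
  d_deriv : ∀ x, HasDerivAt d (-(m * s x * c x)) x

lemma isJacobiTriple_jacobi (m : ℝ) :
    IsJacobiTriple m (jacobiSn m) (jacobiCn m) (jacobiDn m) := by
  obtain ⟨⟨h1, h2, h3⟩, h⟩ := jacobi_ivp m
  exact ⟨h1, h2, h3, fun x => (h x).1, fun x => (h x).2.1, fun x => (h x).2.2⟩

lemma eq_of_hasDerivAt_zero {f : ℝ → ℝ} (hf : ∀ x, HasDerivAt f 0 x) (x y : ℝ) : f x = f y :=
  is_const_of_deriv_eq_zero (fun x => (hf x).differentiableAt) (fun x => (hf x).deriv) x y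

namespace IsJacobiTriple

variable {m : ℝ} {s c d : ℝ → ℝ}

lemma c_sq (h : IsJacobiTriple m s c d) (x : ℝ) : c x ^ 2 = 1 - s x ^ 2 := by
  have := eq_of_hasDerivAt_zero (f := fun x => s x ^ 2 + c x ^ 2) (fun x => by
    refine (((h.s_deriv x).pow 2).add ((h.c_deriv x).pow 2)).congr_deriv ?_
    push_cast
    ring) x 0
  simp only [h.s_zero, h.c_zero] at this
  linarith

lemma d_sq (h : IsJacobiTriple m s c d) (x : ℝ) : d x ^ 2 = 1 - m * s x ^ 2 := by
  have := eq_of_hasDerivAt_zero (f := fun x => m * s x ^ 2 + d x ^ 2) (fun x => by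
    refine ((((h.s_deriv x).pow 2).const_mul m).add ((h.d_deriv x).pow 2)).congr_deriv ?_
    push_cast
    ring) x 0
  simp only [h.s_zero, h.d_zero] at this
  linarith

/-- The vector field is quadratic, hence only locally Lipschitz. The first integrals confine every
solution to this compact convex box, where a Lipschitz constant exists. -/
lemma mem_box (h : IsJacobiTriple m s c d) (x : ℝ) :
    (s x, c x, d x) ∈
      Icc (-1 : ℝ) 1 ×ˢ Icc (-1 : ℝ) 1 ×ˢ Icc (-(1 + |m|)) (1 + |m|) := by
  have h1 := h.c_sq x
  have h2 := h.d_sq x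
  have h3 := sq_nonneg (s x)
  have h4 := sq_nonneg (c x)
  have h5 : d x ^ 2 ≤ (1 + |m|) ^ 2 := by
    nlinarith [neg_abs_le m, abs_nonneg m, mul_nonneg (abs_nonneg m) h4]
  exact ⟨abs_le.1 (abs_le_one_iff_mul_self_le_one.2 (by nlinarith)),
    abs_le.1 (abs_le_one_iff_mul_self_le_one.2 (by nlinarith)),
    abs_le.1 (abs_le_of_sq_le_sq h5 (by positivity))⟩

/-- The Jacobi system determines its solution. -/
theorem unique (h : IsJacobiTriple m s c d) {s' c' d' : ℝ → ℝ}
    (h' : IsJacobiTriple m s' c' d') : s = s' ∧ c = c' ∧ d = d' := by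
  let v : ℝ × ℝ × ℝ → ℝ × ℝ × ℝ :=
    fun p => (p.2.1 * p.2.2, -(p.1 * p.2.2), -(m * p.1 * p.2.1))
  have hv : ContDiff ℝ 1 v := by fun_prop
  obtain ⟨K, hK⟩ := hv.contDiffOn.exists_lipschitzOnWith one_ne_zero
    ((convex_Icc (-1 : ℝ) 1).prod ((convex_Icc (-1 : ℝ) 1).prod
      (convex_Icc (-(1 + |m|)) (1 + |m|))))
    (isCompact_Icc.prod (isCompact_Icc.prod isCompact_Icc))
  have key : (fun x => (s x, c x, d x)) = fun x => (s' x, c' x, d' x) :=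
    ODE_solution_unique_univ (v := fun _ => v) (t₀ := 0) (fun _ => hK)
      (fun x => ⟨(h.s_deriv x).prodMk ((h.c_deriv x).prodMk (h.d_deriv x)), h.mem_box x⟩)
      (fun x => ⟨(h'.s_deriv x).prodMk ((h'.c_deriv x).prodMk (h'.d_deriv x)), h'.mem_box x⟩)
      (by simp [h.s_zero, h.c_zero, h.d_zero, h'.s_zero, h'.c_zero, h'.d_zero])
  refine ⟨?_, ?_, ?_⟩ <;> funext x <;> have := congrFun key x <;> simp_all

/-- The system is invariant under this reflection, so uniqueness yields the parities of the
solution. -/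
lemma neg (h : IsJacobiTriple m s c d) :
    IsJacobiTriple m (fun x => -s (-x)) (fun x => c (-x)) (fun x => d (-x)) where
  s_zero := by simp [h.s_zero]
  c_zero := by simp [h.c_zero]
  d_zero := by simp [h.d_zero]
  s_deriv x := by
    refine ((h.s_deriv (-x)).comp x (hasDerivAt_neg x)).neg.congr_deriv ?_
    ring
  c_deriv x := by
    refine ((h.c_deriv (-x)).comp x (hasDerivAt_neg x)).congr_deriv ?_
    ring
  d_deriv x := by
    refine ((h.d_deriv (-x)).comp x (hasDerivAt_neg x)).congr_deriv ?_
    ring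

lemma neg_apply (h : IsJacobiTriple m s c d) (x : ℝ) :
    s (-x) = -s x ∧ c (-x) = c x := by
  obtain ⟨h1, h2, -⟩ := h.unique h.neg
  exact ⟨by linarith [congrFun h1 x], (congrFun h2 x).symm⟩

end IsJacobiTriple

/-! ### The potential and the gauge factors in the variable `z`. -/

noncomputable section

/-- The branch `cn(√(-k) x | k⁻¹)`, `k = 1 - m`, of `(1 + k z)^{1/2}`. -/
def lameC (m x : ℝ) : ℝ := jacobiCn (1 / (1 - m)) (√(m - 1) * x)

/-- The branch `dn(√(-k) x | k⁻¹)`, `k = 1 - m`, of `(1 + z)^{1/2}`. -/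
def lameD (m x : ℝ) : ℝ := jacobiDn (1 / (1 - m)) (√(m - 1) * x)

end

section lame

variable {m : ℝ}

lemma lameSqrtZ_mul (hm : 1 < m) (x : ℝ) :
    jacobiSn (1 / (1 - m)) (√(m - 1) * x) = √(m - 1) * lameSqrtZ m x := by
  have h := (Real.sqrt_pos.2 (sub_pos.2 hm)).ne'
  rw [lameSqrtZ]
  field_simp

lemma lameSqrtZ_sq (hm : 1 < m) (x : ℝ) : lameSqrtZ m x ^ 2 = lameZ m x := by
  have h : m - 1 ≠ 0 := (sub_pos.2 hm).ne'
  rw [lameSqrtZ, lameZ, div_pow, Real.sq_sqrt (sub_pos.2 hm).le, ← neg_sub m 1, inv_neg, neg_neg]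
  field_simp

lemma lameC_sq (hm : 1 < m) (x : ℝ) : lameC m x ^ 2 = 1 + (1 - m) * lameZ m x := by
  have h : (1 - m) ≠ 0 := by linarith
  rw [lameC, (isJacobiTriple_jacobi _).c_sq, lameZ]
  field_simp
  ring

lemma lameD_sq (x : ℝ) : lameD m x ^ 2 = 1 + lameZ m x := by
  rw [lameD, (isJacobiTriple_jacobi _).d_sq, lameZ]
  ring

lemma lameZ_nonneg (hm : 1 < m) (x : ℝ) : 0 ≤ lameZ m x := by
  rw [← lameSqrtZ_sq hm]
  positivity

lemma one_div_one_sub_lt_one (hm : 1 < m) : 1 / (1 - m) < 1 := by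
  have : 1 / (1 - m) < 0 := one_div_neg.2 (by linarith)
  linarith

lemma lameD_pos (hm : 1 < m) (x : ℝ) : 0 < lameD m x := by
  have h := one_div_one_sub_lt_one hm
  rw [lameD, jacobiDn, if_pos h]
  exact Real.sqrt_pos.2 (ellipticF_radicand_pos h _)

lemma hasDerivAt_sqrt_mul (x : ℝ) : HasDerivAt (fun x => √(m - 1) * x) √(m - 1) x := by
  simpa using (hasDerivAt_id x).const_mul √(m - 1)

lemma lameSqrtZ_hasDerivAt (hm : 1 < m) (x : ℝ) :
    HasDerivAt (lameSqrtZ m) (lameC m x * lameD m x) x := by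
  have h := (Real.sqrt_pos.2 (sub_pos.2 hm)).ne'
  refine ((((isJacobiTriple_jacobi (1 / (1 - m))).s_deriv _).comp x
    (hasDerivAt_sqrt_mul x)).div_const √(m - 1)).congr_deriv ?_
  rw [lameC, lameD]
  field_simp

lemma lameC_hasDerivAt (hm : 1 < m) (x : ℝ) :
    HasDerivAt (lameC m) ((1 - m) * lameSqrtZ m x * lameD m x) x := by
  refine (((isJacobiTriple_jacobi (1 / (1 - m))).c_deriv _).comp x
    (hasDerivAt_sqrt_mul x)).congr_deriv ?_
  have := Real.mul_self_sqrt (sub_pos.2 hm).le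
  rw [lameSqrtZ_mul hm, lameD]
  linear_combination -(lameSqrtZ m x * jacobiDn (1 / (1 - m)) (√(m - 1) * x)) * this

lemma lameD_hasDerivAt (hm : 1 < m) (x : ℝ) :
    HasDerivAt (lameD m) (lameSqrtZ m x * lameC m x) x := by
  refine (((isJacobiTriple_jacobi (1 / (1 - m))).d_deriv _).comp x
    (hasDerivAt_sqrt_mul x)).congr_deriv ?_
  have := Real.mul_self_sqrt (sub_pos.2 hm).le
  have h : (1 - m) ≠ 0 := by linarith
  rw [lameSqrtZ_mul hm, lameC]
  field_simp
  linear_combination -(lameSqrtZ m x * jacobiCn (1 / (1 - m)) (√(m - 1) * x)) * this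

lemma lameZ_hasDerivAt (hm : 1 < m) (x : ℝ) :
    HasDerivAt (lameZ m) (2 * lameSqrtZ m x * lameC m x * lameD m x) x := by
  rw [show lameZ m = fun x => lameSqrtZ m x ^ 2 from funext fun x => (lameSqrtZ_sq hm x).symm]
  refine ((lameSqrtZ_hasDerivAt hm x).pow 2).congr_deriv ?_
  push_cast
  ring

lemma lameSqrtZ_zero : lameSqrtZ m 0 = 0 := by
  simp [lameSqrtZ, (isJacobiTriple_jacobi _).s_zero]

lemma lameC_zero : lameC m 0 = 1 := by simp [lameC, (isJacobiTriple_jacobi _).c_zero]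

lemma lameD_zero : lameD m 0 = 1 := by simp [lameD, (isJacobiTriple_jacobi _).d_zero]

lemma lameSqrtZ_neg (x : ℝ) : lameSqrtZ m (-x) = -lameSqrtZ m x := by
  simp [lameSqrtZ, ((isJacobiTriple_jacobi _).neg_apply _).1, neg_div]

lemma lameC_neg (x : ℝ) : lameC m (-x) = lameC m x := by
  simp [lameC, ((isJacobiTriple_jacobi _).neg_apply _).2]

lemma lameZ_neg (x : ℝ) : lameZ m (-x) = lameZ m x := by
  simp [lameZ, ((isJacobiTriple_jacobi _).neg_apply _).1]

/-- The transformation between the parameters `m` and `1 / (1 - m)`. -/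
lemma isJacobiTriple_lame (hm : 1 < m) :
    IsJacobiTriple m (fun x => lameSqrtZ m x / lameD m x) (fun x => 1 / lameD m x)
      (fun x => lameC m x / lameD m x) where
  s_zero := by simp [lameSqrtZ_zero]
  c_zero := by simp [lameD_zero]
  d_zero := by simp [lameC_zero, lameD_zero]
  s_deriv x := by
    have hd := (lameD_pos hm x).ne'
    refine ((lameSqrtZ_hasDerivAt hm x).div (lameD_hasDerivAt hm x) hd).congr_deriv ?_
    have h1 := lameD_sq (m := m) x
    have h2 := lameSqrtZ_sq hm x
    field_simp
    linear_combination lameC m x * (h1 - h2)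
  c_deriv x := by
    have hd := (lameD_pos hm x).ne'
    refine ((hasDerivAt_const x (1 : ℝ)).div (lameD_hasDerivAt hm x) hd).congr_deriv ?_
    field_simp
    ring
  d_deriv x := by
    have hd := (lameD_pos hm x).ne'
    refine ((lameC_hasDerivAt hm x).div (lameD_hasDerivAt hm x) hd).congr_deriv ?_
    have h1 := lameD_sq (m := m) x
    have h2 := lameC_sq hm x
    field_simp
    linear_combination lameSqrtZ m x * ((1 - m) * h1 - h2)

lemma jacobiSn_eq_lame (hm : 1 < m) (x : ℝ) : jacobiSn m x = lameSqrtZ m x / lameD m x :=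
  congrFun ((isJacobiTriple_jacobi m).unique (isJacobiTriple_lame hm)).1 x

lemma jacobiCn_eq_lame (hm : 1 < m) (x : ℝ) : jacobiCn m x = 1 / lameD m x :=
  congrFun ((isJacobiTriple_jacobi m).unique (isJacobiTriple_lame hm)).2.1 x

/-- The generalized Lamé potential in the algebraic variable. -/
lemma genLamePotential_eq (hm : 1 < m) (l j : ℤ) (x : ℝ) :
    genLamePotential m l j x =
      m * l * (l + 1) * (lameZ m x / lameD m x ^ 2) + (1 - m) * j * (j + 1) * lameZ m x := by
  rw [genLamePotential, jacobiSn_eq_lame hm, lameSqrtZ_mul hm, mul_pow, div_pow,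
    Real.sq_sqrt (sub_pos.2 hm).le, lameSqrtZ_sq hm]
  ring

lemma lameMu1_eq (hm : 1 < m) (l : ℤ) (x : ℝ) : lameMu1 m l x = lameD m x ^ (-l) := by
  rw [lameMu1, jacobiCn_eq_lame hm, one_div, inv_zpow']

lemma lameMu2_eq (hm : 1 < m) (l : ℤ) (x : ℝ) :
    lameMu2 m l x = lameD m x ^ (-l) * lameC m x := by
  rw [← lameMu1_eq hm]
  rfl

lemma lameZ_mem_Icc (hm : 1 < m) (x : ℝ) : lameZ m x ∈ Icc 0 (-(1 - m)⁻¹) := by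
  refine ⟨lameZ_nonneg hm x, ?_⟩
  have h := lameC_sq hm x
  have h2 := sq_nonneg (lameC m x)
  rw [← inv_neg, neg_sub, ← one_div, le_div_iff₀ (sub_pos.2 hm)]
  linarith

lemma lameMu1_eq_rpow (hm : 1 < m) (l : ℤ) (x : ℝ) :
    lameMu1 m l x = (1 + lameZ m x) ^ (-(l : ℝ) / 2) := by
  have hd := lameD_pos hm x
  rw [lameMu1_eq hm, ← lameD_sq, ← Real.rpow_natCast, ← Real.rpow_mul hd.le,
    ← Real.rpow_intCast]
  congr 1
  push_cast
  ring

lemma abs_lameMu2_eq_rpow (hm : 1 < m) (l : ℤ) (x : ℝ) :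
    |lameMu2 m l x| =
      (1 + lameZ m x) ^ (-(l : ℝ) / 2) * √(1 + (1 - m) * lameZ m x) := by
  rw [lameMu2_eq hm, ← lameMu1_eq hm, lameMu1_eq_rpow hm, abs_mul, ← lameC_sq hm,
    Real.sqrt_sq_eq_abs, abs_of_nonneg (Real.rpow_nonneg (by linarith [lameZ_nonneg hm x]) _)]

end lame

/-! ### Derivatives of the four gauge factors. -/

noncomputable section

/-- The exponent of `z^{1/2}` in the gauge factor of a sector. -/
def sectorEps : Fin 4 → ℝ := ![0, 1, 0, 1]

/-- The exponent of `(1 + k z)^{1/2}` in the gauge factor of a sector. -/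
def sectorDel : Fin 4 → ℝ := ![0, 0, 1, 1]

/-- The factor `z^{ε/2} (1 + k z)^{δ/2}` of the gauge factor of a sector. -/
def sectorRoot (m : ℝ) : Fin 4 → ℝ → ℝ :=
  ![fun _ => 1, lameSqrtZ m, lameC m, fun x => lameSqrtZ m x * lameC m x]

/-- The derivative of `sectorRoot`. -/
def sectorRootDeriv (m : ℝ) : Fin 4 → ℝ → ℝ :=
  ![fun _ => 0, fun x => lameC m x * lameD m x, fun x => (1 - m) * lameSqrtZ m x * lameD m x,
    fun x => lameC m x * lameD m x * lameC m x +
      lameSqrtZ m x * ((1 - m) * lameSqrtZ m x * lameD m x)]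

/-- The logarithmic derivative of `lameD`. -/
def lameDLog (m x : ℝ) : ℝ := lameSqrtZ m x * lameC m x / lameD m x

/-- The derivative of `sectorGauge`. -/
def sectorGaugeDeriv (m : ℝ) (l : ℤ) (i : Fin 4) (x : ℝ) : ℝ :=
  lameD m x ^ (-l) * (sectorRootDeriv m i x - l * lameDLog m x * sectorRoot m i x)

/-- The function `z ↦ ε (1 + k z) + δ k z` with `k = 1 - m`. -/
def sectorT (m : ℝ) (i : Fin 4) (z : ℝ) : ℝ :=
  sectorEps i * (1 + (1 - m) * z) + sectorDel i * (1 - m) * z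

/-- The constant term `α` of `V - g'' / g = α + β z` for a gauge factor `g`. -/
def sectorAlpha (m : ℝ) (l : ℤ) (i : Fin 4) : ℝ :=
  (1 + 2 * sectorEps i) * (l - sectorDel i * (1 - m)) - sectorEps i * (2 - m)

/-- The linear coefficient `β` of `V - g'' / g = α + β z` for a gauge factor `g`. -/
def sectorBeta (m : ℝ) (l j : ℤ) (i : Fin 4) : ℝ :=
  -(1 - m) * ((sectorEps i + sectorDel i - l) * (sectorEps i + sectorDel i - l + 1) - j * (j + 1))

end

section gauge

variable {m : ℝ}

lemma sectorGauge_eq (hm : 1 < m) (l : ℤ) (i : Fin 4) (x : ℝ) :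
    sectorGauge m l i x = lameD m x ^ (-l) * sectorRoot m i x := by
  fin_cases i <;> simp [sectorGauge, sectorRoot, lameMu1_eq hm, lameMu2_eq hm]
  ring

lemma lameDLog_hasDerivAt (hm : 1 < m) (x : ℝ) :
    HasDerivAt (lameDLog m)
      (lameC m x ^ 2 + (1 - m) * lameSqrtZ m x ^ 2 - lameDLog m x ^ 2) x := by
  have hd := (lameD_pos hm x).ne'
  refine (((lameSqrtZ_hasDerivAt hm x).mul (lameC_hasDerivAt hm x)).div
    (lameD_hasDerivAt hm x) hd).congr_deriv ?_
  simp only [lameDLog, Pi.mul_apply]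
  field_simp

lemma lameD_zpow_hasDerivAt (hm : 1 < m) (l : ℤ) (x : ℝ) :
    HasDerivAt (fun x => lameD m x ^ (-l)) (-(l * lameDLog m x * lameD m x ^ (-l))) x := by
  have hd := (lameD_pos hm x).ne'
  refine ((hasDerivAt_zpow (-l) _ (Or.inl hd)).comp x (lameD_hasDerivAt hm x)).congr_deriv ?_
  rw [zpow_sub_one₀ hd, lameDLog]
  push_cast
  ring

lemma sectorRoot_hasDerivAt (hm : 1 < m) (i : Fin 4) (x : ℝ) :
    HasDerivAt (sectorRoot m i) (sectorRootDeriv m i x) x := by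
  fin_cases i
  · exact hasDerivAt_const x 1
  · exact lameSqrtZ_hasDerivAt hm x
  · exact lameC_hasDerivAt hm x
  · exact (lameSqrtZ_hasDerivAt hm x).mul (lameC_hasDerivAt hm x)

lemma sectorRootDeriv_hasDerivAt (hm : 1 < m) (i : Fin 4) (x : ℝ) :
    HasDerivAt (sectorRootDeriv m i)
      ((sectorEps i * (2 - m + 2 * (1 - m) * lameZ m x) +
        sectorDel i * (1 - m) * (1 + 2 * lameZ m x) +
        2 * sectorEps i * sectorDel i * (1 - m) * (1 + lameZ m x)) * sectorRoot m i x) x := by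
  have hw := lameSqrtZ_hasDerivAt hm x
  have hc := lameC_hasDerivAt hm x
  have hd := lameD_hasDerivAt hm x
  have h1 := lameSqrtZ_sq hm x
  have h2 := lameC_sq hm x
  have h3 := lameD_sq (m := m) x
  fin_cases i
  · refine (hasDerivAt_const x (0 : ℝ)).congr_deriv ?_
    simp [sectorEps, sectorDel]
  · refine (hc.mul hd).congr_deriv ?_
    simp [sectorEps, sectorDel, sectorRoot]
    linear_combination (1 - m) * lameSqrtZ m x * h3 + lameSqrtZ m x * h2
  · refine ((hw.const_mul (1 - m)).mul hd).congr_deriv ?_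
    simp [sectorEps, sectorDel, sectorRoot]
    linear_combination (1 - m) * lameC m x * h3 + (1 - m) * lameC m x * h1
  · refine (((hc.mul hd).mul hc).add (hw.mul ((hw.const_mul (1 - m)).mul hd))).congr_deriv ?_
    simp [sectorEps, sectorDel, sectorRoot]
    linear_combination lameSqrtZ m x * lameC m x * (4 * (1 - m) * h3 + h2 + (1 - m) * h1)

/-- The logarithmic derivative of the root has poles at the zeros of `w` and `c`; the factor `w c`
in `lameDLog` removes them. The product form stays valid at those zeros. -/
lemma lameDLog_mul_sectorRootDeriv (hm : 1 < m) (i : Fin 4) (x : ℝ) :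
    lameDLog m x * sectorRootDeriv m i x = sectorT m i (lameZ m x) * sectorRoot m i x := by
  have hd := (lameD_pos hm x).ne'
  have h1 := lameSqrtZ_sq hm x
  have h2 := lameC_sq hm x
  fin_cases i <;> simp [sectorEps, sectorDel, sectorRoot, sectorRootDeriv, sectorT, lameDLog] <;>
    field_simp
  · linear_combination lameSqrtZ m x * h2
  · linear_combination (1 - m) * lameC m x * h1
  · linear_combination lameSqrtZ m x * lameC m x * (h2 + (1 - m) * h1)

lemma sectorEps_sq (i : Fin 4) : sectorEps i ^ 2 = sectorEps i := by
  fin_cases i <;> simp [sectorEps]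

lemma sectorDel_sq (i : Fin 4) : sectorDel i ^ 2 = sectorDel i := by
  fin_cases i <;> simp [sectorDel]

lemma sectorGauge_hasDerivAt (hm : 1 < m) (l : ℤ) (i : Fin 4) (x : ℝ) :
    HasDerivAt (sectorGauge m l i) (sectorGaugeDeriv m l i x) x := by
  rw [show sectorGauge m l i = _ from funext (sectorGauge_eq hm l i)]
  refine ((lameD_zpow_hasDerivAt hm l x).mul (sectorRoot_hasDerivAt hm i x)).congr_deriv ?_
  rw [sectorGaugeDeriv]
  ring

lemma lameDLog_sq (hm : 1 < m) (x : ℝ) :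
    lameDLog m x ^ 2 = lameZ m x * (1 + (1 - m) * lameZ m x) / (1 + lameZ m x) := by
  rw [lameDLog, div_pow, mul_pow, lameSqrtZ_sq hm, lameC_sq hm, lameD_sq]

/-- The terms singular at `z = -1` are `l (l + 1) z (1 + k z) / (1 + z)` from `g'' / g` and `m l (l
+ 1) z / (1 + z)` from `V`. Since `1 - m = k`, their difference is `l (l + 1) k z`, so `V - g'' / g`
is linear in `z`. -/
lemma sectorGaugeDeriv_hasDerivAt (hm : 1 < m) (l j : ℤ) (i : Fin 4) (x : ℝ) :
    HasDerivAt (sectorGaugeDeriv m l i)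
      ((genLamePotential m l j x - sectorAlpha m l i - sectorBeta m l j i * lameZ m x) *
        sectorGauge m l i x) x := by
  refine ((lameD_zpow_hasDerivAt hm l x).mul ((sectorRootDeriv_hasDerivAt hm i x).sub
    (((lameDLog_hasDerivAt hm x).const_mul (l : ℝ)).mul
      (sectorRoot_hasDerivAt hm i x)))).congr_deriv ?_
  have h4 := lameDLog_mul_sectorRootDeriv hm i x
  have h5 := lameDLog_sq hm x
  have h6 := sectorEps_sq i
  have h7 := sectorDel_sq i
  have hz : 1 + lameZ m x ≠ 0 := by linarith [lameZ_nonneg hm x]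
  have key : (sectorEps i * (2 - m + 2 * (1 - m) * lameZ m x) +
        sectorDel i * (1 - m) * (1 + 2 * lameZ m x) +
        2 * sectorEps i * sectorDel i * (1 - m) * (1 + lameZ m x)) -
        2 * l * sectorT m i (lameZ m x) + l ^ 2 * lameDLog m x ^ 2 -
        l * (1 + (1 - m) * lameZ m x + (1 - m) * lameZ m x - lameDLog m x ^ 2) =
      genLamePotential m l j x - sectorAlpha m l i - sectorBeta m l j i * lameZ m x := by
    rw [genLamePotential_eq hm, sectorAlpha, sectorBeta, sectorT, h5, lameD_sq]
    field_simp
    -- `sectorBeta` is quadratic in `ε` and `δ`, the left side is linear in each; `ε² = ε` and `δ² =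
    -- δ` reconcile them.
    linear_combination -(1 - m) * lameZ m x * (1 + lameZ m x) * (h6 + h7)
  rw [sectorGauge_eq hm, ← key]
  simp only [Pi.mul_apply, Pi.sub_apply]
  rw [lameC_sq hm, lameSqrtZ_sq hm]
  linear_combination -2 * l * lameD m x ^ (-l) * h4

/-- This is `g' z'`, needed for the cross term of `(g p(z))''`. It is polynomial in `z` times `g`
because `z' = 2 (1 + z) d' / d`. -/
lemma sectorGaugeDeriv_mul (hm : 1 < m) (l : ℤ) (i : Fin 4) (x : ℝ) :
    sectorGaugeDeriv m l i x * (2 * lameSqrtZ m x * lameC m x * lameD m x) =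
      (2 * (1 + lameZ m x) * sectorT m i (lameZ m x) -
        2 * l * lameZ m x * (1 + (1 - m) * lameZ m x)) * sectorGauge m l i x := by
  have hz : 1 + lameZ m x ≠ 0 := by linarith [lameZ_nonneg hm x]
  have h4 := lameDLog_mul_sectorRootDeriv hm i x
  have h5 : lameDLog m x ^ 2 * (1 + lameZ m x) = lameZ m x * (1 + (1 - m) * lameZ m x) := by
    rw [lameDLog_sq hm]
    field_simp
  have h6 : 2 * lameSqrtZ m x * lameC m x * lameD m x = 2 * (1 + lameZ m x) * lameDLog m x := by
    have hd := (lameD_pos hm x).ne'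
    rw [lameDLog, ← lameD_sq]
    field_simp
  rw [h6, sectorGauge_eq hm, sectorGaugeDeriv]
  linear_combination 2 * (1 + lameZ m x) * lameD m x ^ (-l) * h4 -
    2 * l * lameD m x ^ (-l) * sectorRoot m i x * h5

lemma lameSqrtZ_contDiff (hm : 1 < m) :
    ContDiff ℝ ∞ (lameSqrtZ m) ∧ ContDiff ℝ ∞ (lameC m) ∧ ContDiff ℝ ∞ (lameD m) := by
  have hw : deriv (lameSqrtZ m) = fun x => lameC m x * lameD m x :=
    funext fun x => (lameSqrtZ_hasDerivAt hm x).deriv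
  have hc : deriv (lameC m) = fun x => (1 - m) * lameSqrtZ m x * lameD m x :=
    funext fun x => (lameC_hasDerivAt hm x).deriv
  have hd : deriv (lameD m) = fun x => lameSqrtZ m x * lameC m x :=
    funext fun x => (lameD_hasDerivAt hm x).deriv
  have hw' : Differentiable ℝ (lameSqrtZ m) := fun x => (lameSqrtZ_hasDerivAt hm x).differentiableAt
  have hc' : Differentiable ℝ (lameC m) := fun x => (lameC_hasDerivAt hm x).differentiableAt
  have hd' : Differentiable ℝ (lameD m) := fun x => (lameD_hasDerivAt hm x).differentiableAt
  have key : ∀ n : ℕ, ContDiff ℝ n (lameSqrtZ m) ∧ ContDiff ℝ n (lameC m) ∧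
      ContDiff ℝ n (lameD m) := by
    intro n
    induction n with
    | zero => simpa [contDiff_zero] using ⟨hw'.continuous, hc'.continuous, hd'.continuous⟩
    | succ n ih =>
      obtain ⟨h1, h2, h3⟩ := ih
      push_cast
      simp only [contDiff_succ_iff_deriv, hw, hc, hd]
      refine ⟨⟨hw', by simp, by fun_prop⟩, ⟨hc', by simp, by fun_prop⟩, hd', by simp, by fun_prop⟩
  simp only [contDiff_infty]
  exact ⟨fun n => (key n).1, fun n => (key n).2.1, fun n => (key n).2.2⟩

lemma lameZ_contDiff (hm : 1 < m) : ContDiff ℝ ∞ (lameZ m) := by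
  rw [show lameZ m = fun x => lameSqrtZ m x ^ 2 from funext fun x => (lameSqrtZ_sq hm x).symm]
  exact (lameSqrtZ_contDiff hm).1.pow 2

lemma sectorGauge_contDiff (hm : 1 < m) (l : ℤ) (i : Fin 4) :
    ContDiff ℝ ∞ (sectorGauge m l i) := by
  obtain ⟨hw, hc, hd⟩ := lameSqrtZ_contDiff hm
  have hu : ContDiff ℝ ∞ fun x => lameD m x ^ (-l) := by
    obtain ⟨n, hn | hn⟩ := (-l).eq_nat_or_neg
    · simpa [hn] using hd.pow n
    · simp only [hn, zpow_neg, zpow_natCast]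
      exact (hd.pow n).inv fun x => pow_ne_zero n (lameD_pos hm x).ne'
  have hr : ContDiff ℝ ∞ (sectorRoot m i) := by
    fin_cases i
    · exact contDiff_const
    · exact hw
    · exact hc
    · exact hw.mul hc
  rw [show sectorGauge m l i = _ from funext (sectorGauge_eq hm l i)]
  exact hu.mul hr

end gauge

/-! ### Spectral theorem and the quarter period. -/

/-- An operator that is symmetric for some inner product on a finite-dimensional real vector space
has a basis of eigenvectors. -/
theorem exists_basis_eigenvectors_of_symmetric {V : Type*} [AddCommGroup V] [Module ℝ V]
    [FiniteDimensional ℝ V] (B : V → V → ℝ) (hsymm : ∀ x y, B x y = B y x)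
    (hadd : ∀ x y z, B (x + y) z = B x z + B y z) (hsmul : ∀ (r : ℝ) x y, B (r • x) y = r * B x y)
    (hpos : ∀ x, x ≠ 0 → 0 < B x x) (T : V →ₗ[ℝ] V) (hT : ∀ x y, B (T x) y = B x (T y)) :
    ∃ (b : Module.Basis (Fin (Module.finrank ℝ V)) ℝ V) (E : Fin (Module.finrank ℝ V) → ℝ),
      ∀ i, T (b i) = E i • b i := by
  let core : InnerProductSpace.Core ℝ V :=
    { inner := B
      conj_inner_symm := fun x y => hsymm y x
      re_inner_nonneg := fun x => by
        rcases eq_or_ne x 0 with rfl | hx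
        · simpa using (hsmul 0 0 0).ge
        · exact (hpos x hx).le
      add_left := hadd
      smul_left := fun x y r => hsmul r x y
      definite := fun x hx => by
        by_contra h
        exact (hpos x h).ne' hx }
  let : NormedAddCommGroup V := core.toNormedAddCommGroup
  let : InnerProductSpace ℝ V := InnerProductSpace.ofCore core.toCore
  have hT' : T.IsSymmetric := hT
  exact ⟨(hT'.eigenvectorBasis rfl).toBasis, hT'.eigenvalues rfl, fun i => by
    simp [hT'.apply_eigenvectorBasis rfl i]⟩

section quarter

variable {m : ℝ}

/-- The quarter period of `lameC`. -/
lemma exists_lameC_eq_zero (hm : 1 < m) :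
    ∃ K : ℝ, 0 < K ∧ lameC m K = 0 ∧ ∀ x ∈ Ioo 0 K, 0 < lameSqrtZ m x ∧ 0 < lameC m x := by
  set M := 1 / (1 - m) with hM
  have h1 : M < 1 := one_div_one_sub_lt_one hm
  have hκ : 0 < √(m - 1) := Real.sqrt_pos.2 (sub_pos.2 hm)
  have hmono : StrictMono (jacobiAm M) := strictMono_of_deriv_pos fun x => by
    rw [(jacobiAm_hasDerivAt h1 x).deriv]
    exact Real.sqrt_pos.2 (ellipticF_radicand_pos h1 _)
  -- `y` is the complete elliptic integral `F(π/2|M)`; rescaled by `√(m - 1)` it becomes the first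
  -- positive zero of `lameC`.
  obtain ⟨y, hy⟩ : ∃ y, jacobiAm M y = Real.pi / 2 :=
    ⟨_, Function.leftInverse_invFun (ellipticF_bijective h1).1 _⟩
  have hy0 : 0 < y := by
    rw [← hmono.lt_iff_lt, hy, jacobiAm_zero h1]
    positivity
  refine ⟨y / √(m - 1), by positivity, ?_, fun x hx => ?_⟩
  · rw [lameC, mul_div_cancel₀ _ hκ.ne', jacobiCn, if_pos h1, hy, Real.cos_pi_div_two]
  · have h2 : 0 < jacobiAm M (√(m - 1) * x) := by
      rw [← jacobiAm_zero h1]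
      exact hmono (mul_pos hκ hx.1)
    have h3 : jacobiAm M (√(m - 1) * x) < Real.pi / 2 := by
      rw [← hy]
      refine hmono ?_
      rw [mul_comm]
      exact (lt_div_iff₀ hκ).1 hx.2
    rw [lameSqrtZ, lameC, ← hM, jacobiSn, jacobiCn, if_pos h1, if_pos h1]
    exact ⟨div_pos (Real.sin_pos_of_pos_of_lt_pi h2 (by linarith [Real.pi_pos])) hκ,
      Real.cos_pos_of_mem_Ioo ⟨by linarith, h3⟩⟩

/-- On the quarter period `z` takes every value between `z(0) = 0` and `z(K) > 0`, hence infinitely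
many. -/
lemma eq_zero_of_eval_lameZ (hm : 1 < m) {K : ℝ} (hK : 0 < K) (hcK : lameC m K = 0)
    {p : Polynomial ℝ} (hp : ∀ x ∈ Ioo 0 K, p.eval (lameZ m x) = 0) : p = 0 := by
  have h0 : lameZ m 0 = 0 := by simp [← lameSqrtZ_sq hm, lameSqrtZ_zero]
  have h1 : lameZ m 0 < lameZ m K := by
    rw [h0]
    refine (lameZ_nonneg hm K).lt_of_ne fun h => ?_
    have := lameC_sq hm K
    rw [hcK, ← h] at this
    norm_num at this
  have hsub := intermediate_value_Ioo hK.le (lameZ_contDiff hm).continuous.continuousOn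
  refine Polynomial.eq_zero_of_infinite_isRoot p ((Ioo_infinite h1).mono fun t ht => ?_)
  obtain ⟨x, hx, rfl⟩ := hsub ht
  exact hp x hx

end quarter

/-! ### The gauged operator on polynomials. -/

noncomputable section

open Polynomial

/-- The upper off-diagonal coefficient of `sectorOp`. -/
def sectorUpper (m : ℝ) (l j : ℤ) (i : Fin 4) (n : ℕ) : ℝ :=
  -(1 - m) * ((2 * n + (sectorEps i + sectorDel i - l)) *
    (2 * n + (sectorEps i + sectorDel i - l) + 1) - j * (j + 1))

/-- The operator `g⁻¹ H g` on polynomials in `z`, where `g` is the gauge factor of a sector. -/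
def sectorOp (m : ℝ) (l j : ℤ) (i : Fin 4) : ℝ[X] →ₗ[ℝ] ℝ[X] where
  -- The coefficient of `p'` is `z'' + 2 g' z' / g`, and that of `p''` is `z'² = 4 z (1 + z) (1 + k
  -- z)`.
  toFun p := (C (sectorAlpha m l i) + C (sectorBeta m l j i) * X) * p -
    (C (2 + 4 * sectorEps i) +
      C (4 * (2 - m) + 4 * (sectorEps i + (sectorEps i + sectorDel i) * (1 - m)) - 4 * l) * X +
      C ((1 - m) * (6 + 4 * (sectorEps i + sectorDel i - l))) * X ^ 2) * derivative p -
    (C 4 * X + C (4 * (2 - m)) * X ^ 2 + C (4 * (1 - m)) * X ^ 3) * derivative (derivative p)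
  map_add' p q := by
    simp only [map_add]
    ring
  map_smul' r p := by
    simp only [smul_eq_C_mul, RingHom.id_apply, derivative_C_mul]
    ring

/-- The map `p ↦ g p(z)`, where `g` is the gauge factor of a sector. -/
def sectorMap (m : ℝ) (l : ℤ) (i : Fin 4) : ℝ[X] →ₗ[ℝ] ℝ → ℝ where
  toFun p x := sectorGauge m l i x * p.eval (lameZ m x)
  map_add' p q := by
    ext x
    simp [mul_add]
  map_smul' r p := by
    ext x
    simp [mul_left_comm]

/-- The derivative of `sectorMap`. -/
def sectorMapDeriv (m : ℝ) (l : ℤ) (i : Fin 4) (p : ℝ[X]) (x : ℝ) : ℝ :=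
  sectorGaugeDeriv m l i x * p.eval (lameZ m x) + sectorGauge m l i x *
    (p.derivative.eval (lameZ m x) * (2 * lameSqrtZ m x * lameC m x * lameD m x))

end

section op

open Polynomial

variable {m : ℝ}

lemma sectorMap_apply (l : ℤ) (i : Fin 4) (p : ℝ[X]) (x : ℝ) :
    sectorMap m l i p x = sectorGauge m l i x * p.eval (lameZ m x) := rfl

lemma sectorMap_hasDerivAt (hm : 1 < m) (l : ℤ) (i : Fin 4) (p : ℝ[X]) (x : ℝ) :
    HasDerivAt (sectorMap m l i p) (sectorMapDeriv m l i p x) x :=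
  (sectorGauge_hasDerivAt hm l i x).mul
    ((p.hasDerivAt (lameZ m x)).comp x (lameZ_hasDerivAt hm x))

lemma sectorMapDeriv_hasDerivAt (hm : 1 < m) (l j : ℤ) (i : Fin 4) (p : ℝ[X]) (x : ℝ) :
    HasDerivAt (sectorMapDeriv m l i p)
      (genLamePotential m l j x * sectorMap m l i p x -
        sectorMap m l i (sectorOp m l j i p) x) x := by
  have hz := lameZ_hasDerivAt hm x
  have hw := lameSqrtZ_hasDerivAt hm x
  have hc := lameC_hasDerivAt hm x
  have hd := lameD_hasDerivAt hm x
  refine (((sectorGaugeDeriv_hasDerivAt hm l j i x).mul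
    ((p.hasDerivAt (lameZ m x)).comp x hz)).add ((sectorGauge_hasDerivAt hm l i x).mul
      (((p.derivative.hasDerivAt (lameZ m x)).comp x hz).mul
        (((hw.const_mul 2).mul hc).mul hd)))).congr_deriv ?_
  have h1 := lameSqrtZ_sq hm x
  have h2 := lameC_sq hm x
  have h3 := lameD_sq (m := m) x
  have h4 := sectorGaugeDeriv_mul hm l i x
  -- `h5` computes `z'²` and `h6` computes `z''`.
  have h5 : (2 * lameSqrtZ m x * lameC m x * lameD m x) ^ 2 =
      4 * lameZ m x * (1 + (1 - m) * lameZ m x) * (1 + lameZ m x) := by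
    rw [← h1, mul_pow, mul_pow, mul_pow, h2, h3, h1]
    ring
  have h6 : (2 * (lameC m x * lameD m x) * lameC m x +
      2 * lameSqrtZ m x * ((1 - m) * lameSqrtZ m x * lameD m x)) * lameD m x +
      2 * lameSqrtZ m x * lameC m x * (lameSqrtZ m x * lameC m x) =
      2 * (1 + (1 - m) * lameZ m x) * (1 + lameZ m x) +
        2 * (1 - m) * lameZ m x * (1 + lameZ m x) +
        2 * lameZ m x * (1 + (1 - m) * lameZ m x) := by
    rw [← h2, ← h3, ← h1]
    ring
  simp only [sectorMap_apply, sectorOp, LinearMap.coe_mk, AddHom.coe_mk, eval_sub, eval_mul,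
    eval_add, eval_C, eval_X, eval_pow, Function.comp_apply, Pi.mul_apply]
  rw [h6]
  rw [sectorT] at h4
  linear_combination 2 * p.derivative.eval (lameZ m x) * h4 + sectorGauge m l i x *
    p.derivative.derivative.eval (lameZ m x) * h5

lemma schrodingerOp_sectorMap (hm : 1 < m) (l j : ℤ) (i : Fin 4) (p : ℝ[X]) :
    schrodingerOp (genLamePotential m l j) (sectorMap m l i p) =
      sectorMap m l i (sectorOp m l j i p) := by
  funext x
  have h1 : deriv (sectorMap m l i p) = sectorMapDeriv m l i p :=
    funext fun x => (sectorMap_hasDerivAt hm l i p x).deriv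
  rw [schrodingerOp, iteratedDeriv_succ, iteratedDeriv_one, h1,
    (sectorMapDeriv_hasDerivAt hm l j i p x).deriv]
  ring

lemma sectorMap_contDiff (hm : 1 < m) (l : ℤ) (i : Fin 4) (p : ℝ[X]) :
    ContDiff ℝ ∞ (sectorMap m l i p) := by
  have h : ContDiff ℝ ∞ fun t => p.eval t := by simpa using p.contDiff_aeval (𝕜 := ℝ) ∞
  exact (sectorGauge_contDiff hm l i).mul (h.comp (lameZ_contDiff hm))

lemma sectorGauge_pos (hm : 1 < m) (l : ℤ) (i : Fin 4) {x : ℝ} (hw : 0 < lameSqrtZ m x)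
    (hc : 0 < lameC m x) : 0 < sectorGauge m l i x := by
  rw [sectorGauge_eq hm]
  refine mul_pos (zpow_pos (lameD_pos hm x) _) ?_
  fin_cases i <;> simp [sectorRoot, hw, hc]

lemma exists_sectorMap_ne_zero (hm : 1 < m) {K : ℝ} (hK : 0 < K) (hcK : lameC m K = 0)
    (hpos : ∀ x ∈ Ioo 0 K, 0 < lameSqrtZ m x ∧ 0 < lameC m x) (l : ℤ) (i : Fin 4) {p : ℝ[X]}
    (hp : p ≠ 0) : ∃ x ∈ Ioo 0 K, sectorMap m l i p x ≠ 0 := by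
  by_contra! h
  refine hp (eq_zero_of_eval_lameZ hm hK hcK fun x hx => ?_)
  exact (mul_eq_zero.1 (h x hx)).resolve_left
    (sectorGauge_pos hm l i (hpos x hx).1 (hpos x hx).2).ne'

lemma sectorMap_injective (hm : 1 < m) (l : ℤ) (i : Fin 4) :
    Function.Injective (sectorMap m l i) := by
  obtain ⟨K, hK, hcK, hpos⟩ := exists_lameC_eq_zero hm
  refine (injective_iff_map_eq_zero _).2 fun p h => ?_
  by_contra hp
  obtain ⟨x, -, hx⟩ := exists_sectorMap_ne_zero hm hK hcK hpos l i hp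
  exact hx (congrFun h x)

/-- The gauged operator is symmetric for the `L²` inner product over a quarter period. -/
lemma integral_sectorOp_symm (hm : 1 < m) {K : ℝ} (hcK : lameC m K = 0) (l j : ℤ) (i : Fin 4)
    (p q : ℝ[X]) :
    ∫ x in (0 : ℝ)..K, sectorMap m l i (sectorOp m l j i p) x * sectorMap m l i q x =
      ∫ x in (0 : ℝ)..K, sectorMap m l i p x * sectorMap m l i (sectorOp m l j i q) x := by
  have hc : ∀ p, Continuous (sectorMap m l i p) := fun p => (sectorMap_contDiff hm l i p).continuous
  have h1 := hc p
  have h2 := hc q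
  have h3 := hc (sectorOp m l j i p)
  have h4 := hc (sectorOp m l j i q)
  -- Lagrange's identity: the potential terms cancel in the derivative of the Wronskian.
  have hd : ∀ x, HasDerivAt
      (fun x => sectorMap m l i p x * sectorMapDeriv m l i q x -
        sectorMapDeriv m l i p x * sectorMap m l i q x)
      (sectorMap m l i (sectorOp m l j i p) x * sectorMap m l i q x -
        sectorMap m l i p x * sectorMap m l i (sectorOp m l j i q) x) x := fun x => by
    refine (((sectorMap_hasDerivAt hm l i p x).mul (sectorMapDeriv_hasDerivAt hm l j i q x)).sub
      ((sectorMapDeriv_hasDerivAt hm l j i p x).mul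
        (sectorMap_hasDerivAt hm l i q x))).congr_deriv ?_
    ring
  have h5 := intervalIntegral.integral_eq_sub_of_hasDerivAt (a := 0) (b := K) (fun x _ => hd x)
    (((h3.mul h2).sub (h1.mul h4)).intervalIntegrable _ _)
  have h6 : IntervalIntegrable (fun x => sectorMap m l i (sectorOp m l j i p) x *
      sectorMap m l i q x) MeasureTheory.volume 0 K := (h3.mul h2).intervalIntegrable _ _
  have h7 : IntervalIntegrable (fun x => sectorMap m l i p x *
      sectorMap m l i (sectorOp m l j i q) x) MeasureTheory.volume 0 K :=
    (h1.mul h4).intervalIntegrable _ _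
  rw [← sub_eq_zero, ← intervalIntegral.integral_sub h6 h7, h5]
  -- The Wronskian equals `g² (p q' - p' q) z'`, and `z' = 2 w c d` vanishes at both ends: `w = 0`
  -- at `0`, `c = 0` at `K`. No boundary condition on `g` is needed.
  simp only [sectorMapDeriv, sectorMap_apply, hcK, lameSqrtZ_zero]
  ring

lemma coeff_secondOrder (a b r s t u v w : ℝ) (p : ℝ[X]) (n : ℕ) :
    ((C a + C b * X) * p - (C r + C s * X + C t * X ^ 2) * derivative p -
      (C u * X + C v * X ^ 2 + C w * X ^ 3) * derivative (derivative p)).coeff (n + 1) =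
    (b - t * n - w * n * (n - 1)) * p.coeff n + (a - s * (n + 1) - v * (n + 1) * n) *
      p.coeff (n + 1) - (n + 2) * (r + u * (n + 1)) * p.coeff (n + 2) := by
  -- For `n = 0, 1` some of the shifted coefficients do not exist; the factors `n` and `n (n - 1)`
  -- then vanish, so the formula persists.
  match n with
  | 0 =>
    simp [add_mul, mul_assoc, coeff_derivative, coeff_X_pow_mul', coeff_X_mul]
    ring
  | 1 =>
    simp [add_mul, mul_assoc, coeff_derivative, coeff_X_pow_mul', coeff_X_mul]
    ring
  | n + 2 =>
    simp [add_mul, mul_assoc, coeff_derivative, coeff_X_pow_mul', coeff_X_mul]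
    ring

lemma sectorOp_coeff_zero (l j : ℤ) (i : Fin 4) (p : ℝ[X]) :
    (sectorOp m l j i p).coeff 0 =
      sectorAlpha m l i * p.coeff 0 - (2 + 4 * sectorEps i) * p.coeff 1 := by
  simp [sectorOp, mul_coeff_zero, coeff_derivative]

/-- Only the outer entries matter: the upper one for invariance, the lower one for simplicity of
eigenvalues. The diagonal entry is left unspecified. -/
lemma sectorOp_coeff_succ (l j : ℤ) (i : Fin 4) (p : ℝ[X]) (n : ℕ) :
    ∃ a : ℝ, (sectorOp m l j i p).coeff (n + 1) =
      sectorUpper m l j i n * p.coeff n + a * p.coeff (n + 1) -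
        2 * (n + 2) * (2 * n + 3 + 2 * sectorEps i) * p.coeff (n + 2) := by
  refine ⟨sectorAlpha m l i - (4 * (2 - m) + 4 * (sectorEps i + (sectorEps i + sectorDel i) *
    (1 - m)) - 4 * l) * (n + 1) - 4 * (2 - m) * (n + 1) * n,
    (coeff_secondOrder _ _ _ _ _ _ _ _ p n).trans ?_⟩
  rw [sectorUpper, sectorBeta]
  ring

end op

/-! ### Invariance, eigenbases and independence of the sectors. -/

section sector

open Polynomial

variable {m : ℝ}

lemma algSector_eq_map (l j : ℤ) (i : Fin 4) :
    algSector m l j i =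
      (degreeLT ℝ (sectorDegree l j i + 1).toNat).map (sectorMap m l i) := by
  rw [degreeLT_eq_span_X_pow, Submodule.map_span, algSector, polyModule]
  congr 1
  ext f
  simp only [mem_ofPred_eq, Finset.coe_image, Finset.coe_range, mem_image, mem_Iio,
    exists_exists_and_eq_and]
  refine exists_congr fun n => and_congr (by omega) ?_
  rw [eq_comm]
  refine Eq.congr_left (funext fun x => ?_)
  simp [sectorMap_apply]

/-- The roots of `s (s + 1) = j (j + 1)` are `j` and `-j - 1`. At the top degree `s = 2 n + ε + δ -
l` is `j` in the first and last sectors and `-j - 1` in the middle two; equal parity makes the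
halvings exact. -/
lemma sectorUpper_eq_zero {l j : ℤ} (hpar : l ≡ j [ZMOD 2]) {i : Fin 4} {n : ℕ}
    (hn : sectorDegree l j i = n) : sectorUpper m l j i n = 0 := by
  have h1 : l % 2 = j % 2 := hpar
  rw [sectorUpper]
  fin_cases i <;> simp only [sectorDegree, sectorEps, sectorDel, Fin.reduceFinMk, Fin.zero_eta,
    Fin.mk_one, Matrix.cons_val, Matrix.cons_val_zero, Matrix.cons_val_one] at hn ⊢
  · have h2 : (2 * n : ℝ) = l + j := by exact_mod_cast (by omega : 2 * (n : ℤ) = l + j)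
    rw [h2]
    ring
  · have h2 : (2 * n : ℝ) = l - j - 2 := by exact_mod_cast (by omega : 2 * (n : ℤ) = l - j - 2)
    rw [h2]
    ring
  · have h2 : (2 * n : ℝ) = l - j - 2 := by exact_mod_cast (by omega : 2 * (n : ℤ) = l - j - 2)
    rw [h2]
    ring
  · have h2 : (2 * n : ℝ) = l + j - 2 := by exact_mod_cast (by omega : 2 * (n : ℤ) = l + j - 2)
    rw [h2]
    ring

lemma sectorOp_mem_degreeLT {l j : ℤ} (hpar : l ≡ j [ZMOD 2]) (i : Fin 4) {p : ℝ[X]}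
    (hp : p ∈ degreeLT ℝ (sectorDegree l j i + 1).toNat) :
    sectorOp m l j i p ∈ degreeLT ℝ (sectorDegree l j i + 1).toNat := by
  rw [mem_degreeLT, degree_lt_iff_coeff_zero] at hp ⊢
  intro k hk
  cases k with
  | zero => rw [sectorOp_coeff_zero, hp 0 hk, hp 1 (by omega), mul_zero, mul_zero, sub_zero]
  | succ n =>
    obtain ⟨a, ha⟩ := sectorOp_coeff_succ (m := m) l j i p n
    rw [ha, hp (n + 1) hk, hp (n + 2) (by omega)]
    by_cases h : (sectorDegree l j i + 1).toNat ≤ n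
    · rw [hp n h]
      ring
    -- Here `n` is exactly the sector degree.
    · rw [sectorUpper_eq_zero hpar (by omega)]
      ring

lemma sectorEps_nonneg (i : Fin 4) : 0 ≤ sectorEps i := by
  fin_cases i <;> simp [sectorEps]

/-- An eigenvector of the gauged operator is determined by its constant coefficient. -/
lemma eq_zero_of_sectorOp_eq_smul {l j : ℤ} {i : Fin 4} {p : ℝ[X]} {E : ℝ}
    (h : sectorOp m l j i p = E • p) (h0 : p.coeff 0 = 0) : p = 0 := by
  have he := sectorEps_nonneg i
  have h1 : p.coeff 1 = 0 := by
    have := sectorOp_coeff_zero (m := m) l j i p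
    rw [h, coeff_smul, h0, smul_zero, mul_zero, zero_sub, eq_comm, neg_eq_zero] at this
    exact (mul_eq_zero.1 this).resolve_left (by positivity)
  -- The three-term recursion is solved upwards: the factor of `p.coeff (n + 2)` is nonzero since `ε
  -- ≥ 0`.
  have key : ∀ n, p.coeff n = 0 ∧ p.coeff (n + 1) = 0 := by
    intro n
    induction n with
    | zero => exact ⟨h0, h1⟩
    | succ n ih =>
      refine ⟨ih.2, ?_⟩
      obtain ⟨a, ha⟩ := sectorOp_coeff_succ (m := m) l j i p n
      rw [h, coeff_smul, ih.1, ih.2, smul_zero, mul_zero, mul_zero, zero_add, zero_sub, eq_comm,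
        neg_eq_zero] at ha
      exact (mul_eq_zero.1 ha).resolve_left (by positivity)
  ext n
  exact (key n).1

lemma finrank_algSector (hm : 1 < m) (l j : ℤ) (i : Fin 4) :
    Module.Finite ℝ (algSector m l j i) ∧
      Module.finrank ℝ (algSector m l j i) = (sectorDegree l j i + 1).toNat := by
  let e : (Fin (sectorDegree l j i + 1).toNat → ℝ) ≃ₗ[ℝ] algSector m l j i :=
    (degreeLTEquiv ℝ _).symm ≪≫ₗ Submodule.equivMapOfInjective _ (sectorMap_injective hm l i) _ ≪≫ₗ
      LinearEquiv.ofEq _ _ (algSector_eq_map l j i).symm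
  exact ⟨Module.Finite.equiv e, by rw [← e.finrank_eq, Module.finrank_fin_fun]⟩

/-- Every sector has a basis of eigenfunctions, and each eigenfunction in the sector is
proportional to a member of it. -/
theorem exists_eigenfunctions_algSector (hm : 1 < m) {l j : ℤ} (hpar : l ≡ j [ZMOD 2])
    (i : Fin 4) :
    ∃ v : Fin (sectorDegree l j i + 1).toNat → ℝ → ℝ, LinearIndependent ℝ v ∧
      (∀ a, v a ∈ algSector m l j i ∧
        ∃ E : ℝ, schrodingerOp (genLamePotential m l j) (v a) = E • v a) ∧
      ∀ φ ∈ algSector m l j i, φ ≠ 0 →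
        (∃ E : ℝ, schrodingerOp (genLamePotential m l j) φ = E • φ) →
        ∃ a, ∃ c : ℝ, c ≠ 0 ∧ φ = c • v a := by
  obtain ⟨K, hK, hcK, hpos⟩ := exists_lameC_eq_zero hm
  have hcont : ∀ p, Continuous (sectorMap m l i p) :=
    fun p => (sectorMap_contDiff hm l i p).continuous
  have hint : ∀ p q, IntervalIntegrable (fun x => sectorMap m l i p x * sectorMap m l i q x)
      MeasureTheory.volume 0 K := fun p q => ((hcont p).mul (hcont q)).intervalIntegrable _ _
  have hinj := sectorMap_injective hm l i
  set N := (sectorDegree l j i + 1).toNat with hN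
  let T : degreeLT ℝ N →ₗ[ℝ] degreeLT ℝ N :=
    (sectorOp m l j i).restrict fun p hp => sectorOp_mem_degreeLT hpar i hp
  have : FiniteDimensional ℝ (degreeLT ℝ N) := Module.Finite.equiv (degreeLTEquiv ℝ N).symm
  have hfr : Module.finrank ℝ (degreeLT ℝ N) = N := by
    rw [(degreeLTEquiv ℝ N).finrank_eq, Module.finrank_fin_fun]
  obtain ⟨b', E', hb'⟩ := exists_basis_eigenvectors_of_symmetric
    (fun p q : degreeLT ℝ N => ∫ x in (0 : ℝ)..K, sectorMap m l i p x * sectorMap m l i q x)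
    (fun p q => by simp only [mul_comm])
    (fun p q r => by
      rw [← intervalIntegral.integral_add (hint _ _) (hint _ _)]
      simp [add_mul])
    (fun r p q => by
      rw [← intervalIntegral.integral_const_mul]
      simp [mul_assoc])
    (fun p hp => by
      obtain ⟨x, hx, hne⟩ := exists_sectorMap_ne_zero hm hK hcK hpos l i
        (p := (p : ℝ[X])) (by simpa using hp)
      exact intervalIntegral.integral_pos hK ((hcont _).mul (hcont _)).continuousOn
        (fun x _ => mul_self_nonneg _) ⟨x, Ioo_subset_Icc_self hx, mul_self_pos.2 hne⟩)
    T (fun p q => integral_sectorOp_symm hm hcK l j i p q)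
  let b := b'.reindex (finCongr hfr)
  let E : Fin N → ℝ := fun a => E' ((finCongr hfr).symm a)
  have hb : ∀ a, T (b a) = E a • b a := fun a => by simp [b, E, hb']
  have hb2 : ∀ a, sectorOp m l j i (b a) = E a • (b a : ℝ[X]) := fun a =>
    congrArg Subtype.val (hb a)
  refine ⟨fun a => sectorMap m l i (b a), ?_, fun a => ⟨?_, E a, ?_⟩, ?_⟩
  · exact (b.linearIndependent.map' (degreeLT ℝ N).subtype (by simp)).map' _
      (LinearMap.ker_eq_bot.2 hinj)
  · rw [algSector_eq_map]
    exact Submodule.mem_map_of_mem (b a).2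
  · rw [schrodingerOp_sectorMap hm, hb2, map_smul]
  · rintro φ hφ hφ0 ⟨e, he⟩
    rw [algSector_eq_map] at hφ
    obtain ⟨p, hp, rfl⟩ := hφ
    have hp0 : p ≠ 0 := by
      rintro rfl
      exact hφ0 (map_zero _)
    rw [schrodingerOp_sectorMap hm, ← map_smul] at he
    replace he := hinj he
    let P : degreeLT ℝ N := ⟨p, hp⟩
    have hTP : T P = e • P := Subtype.ext he
    -- Any basis vector occurring in `P` has the same eigenvalue `e`; rescaled to the constant
    -- coefficient of `p`, it must then equal `p`.
    obtain ⟨a, ha⟩ : ∃ a, b.repr P a ≠ 0 := by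
      by_contra! h
      have : P = 0 := b.repr.map_eq_zero_iff.1 (Finsupp.ext h)
      exact hp0 (congrArg Subtype.val this)
    have hE : E a = e := by
      have h1 : T P = ∑ c, (b.repr P c * E c) • b c := by
        conv_lhs => rw [← b.sum_repr P]
        simp only [map_sum, map_smul, hb, smul_smul]
      have h2 : b.repr (T P) a = b.repr P a * E a := by rw [h1, b.repr_sum_self]
      rw [hTP, map_smul, Finsupp.smul_apply, smul_eq_mul, mul_comm] at h2
      exact (mul_left_cancel₀ ha h2).symm
    have hba : (b a : ℝ[X]).coeff 0 ≠ 0 := fun h =>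
      b.ne_zero a (Subtype.ext (eq_zero_of_sectorOp_eq_smul (hb2 a) h))
    have hpa : p.coeff 0 ≠ 0 := fun h => hp0 (eq_zero_of_sectorOp_eq_smul he h)
    refine ⟨a, p.coeff 0 / (b a : ℝ[X]).coeff 0, div_ne_zero hpa hba, ?_⟩
    rw [← map_smul]
    congr 1
    rw [← sub_eq_zero]
    refine eq_zero_of_sectorOp_eq_smul (m := m) (l := l) (j := j) (i := i) (E := e) ?_ ?_
    · rw [map_sub, map_smul, he, hb2, hE, smul_sub, smul_comm]
    · simp [div_mul_cancel₀ _ hba]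

/-- Multiplying by the conjugate gives `p² = (1 + k z) q²`, where the degrees have opposite parity
unless `q = 0`. -/
lemma eq_zero_of_add_lameC_mul (hm : 1 < m) {K : ℝ} (hK : 0 < K) (hcK : lameC m K = 0)
    {p q : ℝ[X]}
    (h : ∀ x ∈ Ioo 0 K, p.eval (lameZ m x) + lameC m x * q.eval (lameZ m x) = 0) :
    p = 0 ∧ q = 0 := by
  have h1 : p ^ 2 = (C (1 - m) * X + C 1) * q ^ 2 := by
    rw [← sub_eq_zero]
    refine eq_zero_of_eval_lameZ hm hK hcK fun x hx => ?_
    have h2 := h x hx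
    have h3 := lameC_sq hm x
    simp only [eval_sub, eval_mul, eval_pow, eval_add, eval_C, eval_X]
    linear_combination (p.eval (lameZ m x) - lameC m x * q.eval (lameZ m x)) * h2 +
      q.eval (lameZ m x) ^ 2 * h3
  have hq : q = 0 := by
    by_contra hq
    have hk : 1 - m ≠ 0 := by linarith
    have h2 := congrArg natDegree h1
    rw [natDegree_pow, natDegree_mul (fun h => by
      have := natDegree_linear (b := 1) hk
      rw [h] at this
      simp at this) (pow_ne_zero 2 hq), natDegree_linear hk, natDegree_pow] at h2
    omega
  refine ⟨?_, hq⟩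
  rw [hq] at h1
  simpa using h1

/-- After division by `d^(-l)`, the reflection `x ↦ -x` separates the sectors with a factor `w` from
those without; within each pair `eq_zero_of_add_lameC_mul` applies. -/
lemma iSupIndep_algSector (hm : 1 < m) (l j : ℤ) : iSupIndep (algSector m l j) := by
  obtain ⟨K, hK, hcK, hpos⟩ := exists_lameC_eq_zero hm
  have key : ∀ p : Fin 4 → ℝ[X], ∑ i, sectorMap m l i (p i) = 0 → ∀ i, p i = 0 := by
    intro p hp
    have h1 : ∀ x, (p 0).eval (lameZ m x) + lameSqrtZ m x * (p 1).eval (lameZ m x) +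
        lameC m x * (p 2).eval (lameZ m x) +
        lameSqrtZ m x * lameC m x * (p 3).eval (lameZ m x) = 0 := by
      intro x
      have h2 := congrFun hp x
      have hu : lameD m x ^ (-l) ≠ 0 := (zpow_pos (lameD_pos hm x) _).ne'
      simp only [Finset.sum_apply, Fin.sum_univ_four, sectorMap_apply, sectorGauge_eq hm,
        Pi.zero_apply] at h2
      simp only [sectorRoot, Matrix.cons_val] at h2
      refine (mul_eq_zero.1 (Eq.trans ?_ h2)).resolve_left hu
      ring
    have h2 : ∀ x, (p 0).eval (lameZ m x) - lameSqrtZ m x * (p 1).eval (lameZ m x) +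
        lameC m x * (p 2).eval (lameZ m x) -
        lameSqrtZ m x * lameC m x * (p 3).eval (lameZ m x) = 0 := by
      intro x
      have := h1 (-x)
      rw [lameZ_neg, lameSqrtZ_neg, lameC_neg] at this
      linarith
    obtain ⟨h3, h4⟩ := eq_zero_of_add_lameC_mul hm hK hcK (p := p 0) (q := p 2)
      fun x _ => by linarith [h1 x, h2 x]
    obtain ⟨h5, h6⟩ := eq_zero_of_add_lameC_mul hm hK hcK (p := p 1) (q := p 3) fun x hx => by
      refine (mul_eq_zero.1 (?_ : lameSqrtZ m x * _ = 0)).resolve_left (hpos x hx).1.ne'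
      linarith [h1 x, h2 x]
    intro i
    fin_cases i
    exacts [h3, h5, h4, h6]
  classical
  rw [iSupIndep_iff_finsetSum_eq_zero_imp_eq_zero]
  intro s v hv hsum i hi
  -- The family is extended by zero outside `s`, so that `key` applies to all four sectors.
  have h1 : ∀ i, ∃ p, sectorMap m l i p = if i ∈ s then v i else 0 := by
    intro i
    split_ifs with h
    · have := hv i h
      rw [algSector_eq_map] at this
      obtain ⟨p, -, hp⟩ := this
      exact ⟨p, hp⟩
    · exact ⟨0, map_zero _⟩
  choose p hp using h1
  have h2 := hp i
  rw [key p (by simpa [hp] using hsum) i, map_zero, if_pos hi] at h2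
  exact h2.symm

/-- The bound on `j` makes every degree at least `-1`, so `toNat` truncates nothing. -/
lemma sum_sectorDegree {l j : ℤ} (hpar : l ≡ j [ZMOD 2]) (hj : |j| ≤ l) :
    ∑ i : Fin 4, (sectorDegree l j i + 1).toNat = (2 * l + 1).toNat := by
  have h1 : l % 2 = j % 2 := hpar
  have h2 := abs_le.1 hj
  simp only [Fin.sum_univ_four, sectorDegree, Matrix.cons_val]
  omega

end sector

/-! ### The count of algebraic eigenfunctions. -/

theorem mainTheorem5 (m : ℝ) (hm : 1 < m) (l j : ℤ) (hpar : l ≡ j [ZMOD 2]) :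
    -- the change of variable and the gauge factors, with `k = 1 - m`
    (∀ x : ℝ, lameZ m x ∈ Set.Icc 0 (-(1 - m)⁻¹) ∧ lameSqrtZ m x ^ 2 = lameZ m x ∧
      lameMu1 m l x = (1 + lameZ m x) ^ (-(l : ℝ) / 2) ∧
      |lameMu2 m l x| = (1 + lameZ m x) ^ (-(l : ℝ) / 2) * √(1 + (1 - m) * lameZ m x)) ∧
    -- the four sectors consist of smooth functions and are invariant under `H`
    (∀ i : Fin 4, ∀ ψ ∈ algSector m l j i, ContDiff ℝ ∞ ψ ∧
      schrodingerOp (genLamePotential m l j) ψ ∈ algSector m l j i) ∧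
    -- their dimensions, and their independence
    (∀ i : Fin 4, Module.Finite ℝ (algSector m l j i) ∧
      Module.finrank ℝ (algSector m l j i) = (sectorDegree l j i + 1).toNat) ∧
    iSupIndep (algSector m l j) ∧
    -- up to nonzero factors there are exactly `2l + 1` algebraic eigenfunctions
    (|j| ≤ l →
      (∑ i : Fin 4, (Module.finrank ℝ (algSector m l j i) : ℤ)) = 2 * l + 1 ∧
      ∃ ψ : Fin (2 * l + 1).toNat → ℝ → ℝ, LinearIndependent ℝ ψ ∧
        (∀ a, IsAlgEigenfunction m l j (ψ a)) ∧
        ∀ φ, IsAlgEigenfunction m l j φ → ∃! a, ∃ c : ℝ, c ≠ 0 ∧ φ = c • ψ a) := by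
  refine ⟨fun x => ⟨lameZ_mem_Icc hm x, lameSqrtZ_sq hm x, lameMu1_eq_rpow hm l x,
    abs_lameMu2_eq_rpow hm l x⟩, fun i ψ hψ => ?_, finrank_algSector hm l j,
    iSupIndep_algSector hm l j, fun hj => ⟨?_, ?_⟩⟩
  · rw [algSector_eq_map] at hψ ⊢
    obtain ⟨p, hp, rfl⟩ := hψ
    rw [schrodingerOp_sectorMap hm]
    exact ⟨sectorMap_contDiff hm l i p, Submodule.mem_map_of_mem (sectorOp_mem_degreeLT hpar i hp)⟩
  · have hl : 0 ≤ l := (abs_nonneg j).trans hj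
    simp only [(finrank_algSector hm l j _).2]
    rw [← Nat.cast_sum, sum_sectorDegree hpar hj]
    omega
  · choose v hli hv hex using exists_eigenfunctions_algSector hm hpar (l := l) (j := j)
    have hle : ∀ i, Submodule.span ℝ (Set.range (v i)) ≤ algSector m l j i := fun i =>
      Submodule.span_le.2 (Set.range_subset_iff.2 fun a => (hv i a).1)
    have hsigma : LinearIndependent ℝ
        fun a : Σ i, Fin (sectorDegree l j i + 1).toNat => v a.1 a.2 := by
      refine linearIndependent_iUnion_finite hli fun i t _ hit => ?_
      refine (iSupIndep_algSector hm l j i).mono (hle i) (iSup₂_le fun k hk => ?_)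
      exact (hle k).trans (le_iSup₂_of_le k (fun h => hit (h ▸ hk)) le_rfl)
    have hcard : Fintype.card (Σ i, Fin (sectorDegree l j i + 1).toNat) = (2 * l + 1).toNat := by
      simp [sum_sectorDegree hpar hj]
    let e := (Fintype.equivFinOfCardEq hcard).symm
    have hψ := hsigma.comp e e.injective
    refine ⟨fun a => v (e a).1 (e a).2, hψ, fun a => ⟨hψ.ne_zero a, ⟨_, (hv _ _).1⟩, (hv _ _).2⟩,
      ?_⟩
    rintro φ ⟨hφ0, ⟨i, hi⟩, hE⟩
    obtain ⟨a, c, hc, rfl⟩ := hex i φ hi hφ0 hE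
    refine ⟨e.symm ⟨i, a⟩, ⟨c, hc, congrArg
      (fun b : Σ i, Fin (sectorDegree l j i + 1).toNat => c • v b.1 b.2)
      (e.apply_symm_apply ⟨i, a⟩).symm⟩, ?_⟩
    rintro a' ⟨c', hc', h⟩
    by_contra hne
    -- A second index would make two distinct members of the independent family proportional.
    have h1 : v i a = (c⁻¹ * c') • v (e a').1 (e a').2 := by
      rw [mul_smul, ← h, inv_smul_smul₀ hc]
    have h2 : (⟨i, a⟩ : Σ i, Fin (sectorDegree l j i + 1).toNat) ≠ e a' := fun h3 =>
      hne (by rw [h3, e.symm_apply_apply])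
    refine hsigma.notMem_span_image (s := {e a'}) (x := ⟨i, a⟩) (by simpa using h2) ?_
    rw [h1, Set.image_singleton]
    exact Submodule.smul_mem _ _ (Submodule.mem_span_singleton_self _)
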